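/- Let $L\ge 4$ be an even integer, let $1\le K\le N_t$ be integers, and put $\eta=N_t/K$. Let $\mathbf H\in\mathbb C^{K\times N_t}$ have i.i.d. $\mathcal{CN}(0,1)$ entries (i.i.d. Rayleigh fading), and let the messages $m_1,\dots,m_K$ be independent, uniform on $\{0,\dots,L^2-1\}$, and independent of $\mathbf H$. Put $$\dot{\mathbf H}=\begin{pmatrix}\Re\mathbf H&-\Im\mathbf H\\ \Im\mathbf H&\Re\mathbf H\end{pmatrix}\in\mathbb R^{2K\times 2N_t},\qquad \ell_k=m_k \bmod L,\quad \ell_{K+k}=\lfloor m_k/L\rfloor\quad(1\le k\le K),$$ and let $\mathcal I_{\mathrm{in}}=\{i:1\le \ell_i\le L-2\}$ be the set of indices of the interior symbols. Let $\alpha'^2$ be the optimal value of the relaxed constructive-interference-precoding problem for $L^2$-QAM, in which the interior symbols are fixed and the constraints on the end symbols ($\ell_i\in\{0,L-1\}$) are removed: $$\alpha'^2=\inf\bigl\{\dot{\mathbf s}^{\mathsf T}(\dot{\mathbf H}\dot{\mathbf H}^{\mathsf T})^{-1}\dot{\mathbf s}\;:\;\dot{\mathbf s}\in\mathbb R^{2K},\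 \dot s_i=2\ell_i-L+1\ \text{for all } i\in\mathcal I_{\mathrm{in}}\bigr\}.$$ Let $E_{s,\mathrm{in}}=\frac1{L-2}\sum_{\ell=1}^{L-2}(2\ell-L+1)^2$, and let $\mathbb E(\alpha'^2)\in[0,\infty]$ be the expectation over $\mathbf H$ and the messages. Then, whenever $\eta>1$, $$\mathbb E(\alpha'^2)\ \ge\ \frac{2E_{s,\mathrm{in}}}{\eta L/(L-2)-1}.$$ When $\eta=1$, that is $N_t=K$, the inequality holds asymptotically as $K\to\infty$ with $L$ fixed: $$\liminf_{K\to\infty}\mathbb E(\alpha'^2)\ \ge\ \frac{2E_{s,\mathrm{in}}}{L/(L-2)-1}.$$ -/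

import Mathlib

open MeasureTheory ProbabilityTheory Filter
open scoped ENNReal NNReal Matrix

noncomputable section

namespace QamCip

/-- The circularly symmetric complex Gaussian law `CN(0, 1)`: the real and the imaginary part are
independent real Gaussians with mean `0` and variance `1/2`. -/
def stdComplexGaussian : Measure ℂ :=
  ((gaussianReal 0 (1 / 2)).prod (gaussianReal 0 (1 / 2))).map (fun p : ℝ × ℝ => (⟨p.1, p.2⟩ : ℂ))

/-- The i.i.d. Rayleigh fading channel: all the gains `h k n` (user `k`, antenna `n`) are
independent with law `CN(0, 1)`. -/
def channelLaw (K Nt : ℕ) : Measure (Fin K → Fin Nt → ℂ) :=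
  Measure.pi fun _ => Measure.pi fun _ => stdComplexGaussian

/-- The messages of the `K` users are independent and uniform on `{0, …, M - 1}`, `M = L ^ 2`. -/
def messageLaw (K L : ℕ) : Measure (Fin K → Fin (L ^ 2)) :=
  Measure.pi fun _ => uniformOn Set.univ

/-- The real-valued representation `[Re H, -Im H; Im H, Re H]` of the complex channel matrix. -/
def realChannel {K Nt : ℕ} (h : Fin K → Fin Nt → ℂ) :
    Matrix (Fin K ⊕ Fin K) (Fin Nt ⊕ Fin Nt) ℝ :=
  Matrix.fromBlocks (Matrix.of fun k n => (h k n).re) (Matrix.of fun k n => -(h k n).im)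
    (Matrix.of fun k n => (h k n).im) (Matrix.of fun k n => (h k n).re)

/-- The real-domain messages `[m mod L, ⌊m / L⌋]`, with values in `{0, …, L - 1}`. -/
def realMessage {K L : ℕ} (m : Fin K → Fin (L ^ 2)) : Fin K ⊕ Fin K → ℕ :=
  Sum.elim (fun k => (m k : ℕ) % L) (fun k => (m k : ℕ) / L)

/-- The index set of the interior symbols, those with `1 ≤ ℓ ≤ L - 2`; the other indices carry the
end symbols `ℓ = 0` and `ℓ = L - 1`. -/
def interiorSet {K L : ℕ} (m : Fin K → Fin (L ^ 2)) : Set (Fin K ⊕ Fin K) :=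
  {i | 1 ≤ realMessage m i ∧ realMessage m i + 2 ≤ L}

/-- The feasible set of the relaxed problem: an interior symbol is fixed to its PAM point
`2 ℓ - L + 1`, and an end symbol is unconstrained. -/
def relaxedFeasible {K L : ℕ} (m : Fin K → Fin (L ^ 2)) : Set (Fin K ⊕ Fin K → ℝ) :=
  {s | ∀ i ∈ interiorSet m, s i = 2 * (realMessage m i : ℝ) - (L : ℝ) + 1}

/-- The objective `sᵀ (H Hᵀ)⁻¹ s`, with `H` the real-valued channel matrix. -/
def objective {K Nt : ℕ} (h : Fin K → Fin Nt → ℂ) (s : Fin K ⊕ Fin K → ℝ) : ℝ :=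
  s ⬝ᵥ ((realChannel h * (realChannel h)ᵀ)⁻¹ *ᵥ s)

/-- The optimal value `α'²` of the relaxed problem. -/
def relaxedValue {K Nt L : ℕ} (h : Fin K → Fin Nt → ℂ) (m : Fin K → Fin (L ^ 2)) : ℝ :=
  sInf (objective h '' relaxedFeasible m)

/-- The expectation of `α'²` over independent channel and messages, with values in `[0, ∞]`. -/
def expectedRelaxedValue (K Nt L : ℕ) : ℝ≥0∞ :=
  ∫⁻ x : (Fin K → Fin Nt → ℂ) × (Fin K → Fin (L ^ 2)),
    ENNReal.ofReal (relaxedValue x.1 x.2) ∂((channelLaw K Nt).prod (messageLaw K L))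

/-- The average energy per real dimension of the interior symbols. -/
def interiorEnergy (L : ℕ) : ℝ :=
  (∑ l ∈ Finset.Icc 1 (L - 2), (2 * (l : ℝ) - (L : ℝ) + 1) ^ 2) / ((L : ℝ) - 2)

/-- The bound `2 E / (η L / (L - 2) - 1)`, with `E` the energy of the interior symbols. -/
def lowerBound (L : ℕ) (η : ℝ) : ℝ :=
  2 * interiorEnergy L / (η * (L : ℝ) / ((L : ℝ) - 2) - 1)

end QamCip

end

noncomputable section

namespace QamCip

/-! ### Inverse moments of Gaussian norms. -/

section Gaussian

/-! Let `I` be the random set of interior indices and `G` the Gram matrix of the channel rows in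
`I`. Deleting coordinates can only lower an inverse quadratic form, so the relaxed value is at least
the form of `G⁻¹` at the interior PAM points (`le_relaxedValue`). Reflecting one symbol changes the
sign of its PAM point and preserves `I`, so averaging over messages leaves only the diagonal terms
(`sum_quadratic_eq_sum_diag`).

The entry `G⁻¹ i i` is the inverse squared distance of row `i` from the span of the other rows.
Discarding the companion row of the same user, which is not independent of row `i`, only increases
the distance. The rows that remain are independent of row `i` and span at least `|I| - 2`
dimensions. Hence a Gaussian vector of variance `1/2` is projected to dimension at most `2N - |I| +
2`, and the inverse chi-square mean gives at least `2 / (2N - |I|)` (`le_lintegral_gram_inv`): the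
two discarded dimensions cancel the `-2` of that mean.

This bound is convex in `|I|`, so it lies above its tangent at the mean `2K(L-2)/L`. The interior
energy and `|I|` are nonnegatively correlated, so the linear term can be dropped
(`le_sum_energy_mul_affine`). The resulting bound holds for every `0 < K ≤ N`, so the case `η = 1`
needs no limiting argument. -/

theorem lintegral_exp_neg_mul_sq_gaussianReal {s : ℝ} (hs : 0 ≤ s) :
    ∫⁻ x, ENNReal.ofReal (Real.exp (-s * x ^ 2)) ∂(gaussianReal 0 1) =
      ENNReal.ofReal ((1 + 2 * s) ^ (-(1 / 2) : ℝ)) := by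
  have hb : 0 < s + 1 / 2 := by linarith
  have hdens : ∀ x : ℝ, gaussianPDF 0 1 x * ENNReal.ofReal (Real.exp (-s * x ^ 2)) =
      ENNReal.ofReal ((√(2 * Real.pi))⁻¹ * Real.exp (-(s + 1 / 2) * x ^ 2)) := by
    intro x
    rw [gaussianPDF, ← ENNReal.ofReal_mul (gaussianPDFReal_nonneg _ _ _), gaussianPDFReal]
    congr 1
    rw [mul_assoc, ← Real.exp_add]
    simp only [NNReal.coe_one, mul_one, sub_zero]
    ring_nf
  rw [gaussianReal_of_var_ne_zero _ one_ne_zero,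
    lintegral_withDensity_eq_lintegral_mul _ (measurable_gaussianPDF _ _) (by fun_prop)]
  simp only [Pi.mul_apply, hdens]
  rw [← ofReal_integral_eq_lintegral_ofReal ((integrable_exp_neg_mul_sq hb).const_mul _)
    (ae_of_all _ fun x => by positivity), integral_const_mul, integral_gaussian]
  congr 1
  have h2 : 0 < 1 + 2 * s := by linarith
  rw [Real.rpow_neg h2.le, ← Real.sqrt_eq_rpow, ← Real.sqrt_inv, ← Real.sqrt_inv,
    ← Real.sqrt_mul (by positivity)]
  congr 1
  field_simp
  ring

variable {E : Type*} [NormedAddCommGroup E] [InnerProductSpace ℝ E] [FiniteDimensional ℝ E]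
  [MeasurableSpace E] [BorelSpace E]

theorem lintegral_exp_neg_mul_sq_stdGaussian {s : ℝ} (hs : 0 ≤ s) :
    ∫⁻ z, ENNReal.ofReal (Real.exp (-s * ‖z‖ ^ 2)) ∂(stdGaussian E) =
      ENNReal.ofReal ((1 + 2 * s) ^ (-(Module.finrank ℝ E / 2) : ℝ)) := by
  have hnorm : ∀ x : Fin (Module.finrank ℝ E) → ℝ,
      ENNReal.ofReal (Real.exp (-s * ‖∑ i, x i • stdOrthonormalBasis ℝ E i‖ ^ 2)) =
        ∏ i, ENNReal.ofReal (Real.exp (-s * x i ^ 2)) := by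
    intro x
    rw [← ENNReal.ofReal_prod_of_nonneg fun i _ => (Real.exp_pos _).le, ← Real.exp_sum,
      ← Finset.mul_sum, ← (stdOrthonormalBasis ℝ E).sum_sq_norm_inner_right]
    simp only [(stdOrthonormalBasis ℝ E).orthonormal.inner_right_fintype, Real.norm_eq_abs, sq_abs]
  rw [stdGaussian, lintegral_map (by fun_prop) (by fun_prop)]
  simp only [hnorm]
  have hind := iIndepFun_pi (Ω := fun _ : Fin (Module.finrank ℝ E) => ℝ)
    (μ := fun _ => gaussianReal 0 1)
    (X := fun _ x => ENNReal.ofReal (Real.exp (-s * x ^ 2))) (fun i => by fun_prop)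
  rw [lintegral_prod_eq_prod_lintegral_of_indepFun _ _ hind (fun i => by fun_prop)]
  have heval : ∀ i : Fin (Module.finrank ℝ E),
      ∫⁻ a : Fin (Module.finrank ℝ E) → ℝ, ENNReal.ofReal (Real.exp (-s * a i ^ 2))
        ∂(Measure.pi fun _ => gaussianReal 0 1) =
      ENNReal.ofReal ((1 + 2 * s) ^ (-(1 / 2) : ℝ)) := fun i => by
    rw [← lintegral_exp_neg_mul_sq_gaussianReal hs]
    exact (measurePreserving_eval (fun _ => gaussianReal 0 1) i).lintegral_comp
      (f := fun x => ENNReal.ofReal (Real.exp (-s * x ^ 2))) (by fun_prop)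
  simp only [heval, Finset.prod_const, Finset.card_univ, Fintype.card_fin]
  have h2 : 0 < 1 + 2 * s := by linarith
  rw [← ENNReal.ofReal_pow (by positivity), ← Real.rpow_natCast, ← Real.rpow_mul h2.le]
  congr 2
  ring

theorem lintegral_Ioi_exp_neg_mul_le (r : ℝ) (hr : 0 ≤ r) :
    ∫⁻ t in Set.Ioi (0 : ℝ), ENNReal.ofReal (Real.exp (-t * r)) ≤ (ENNReal.ofReal r)⁻¹ := by
  rcases hr.eq_or_lt with rfl | hr
  · simp
  · have hI := integrableOn_exp_mul_Ioi (a := -r) (by linarith) 0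
    have hv := integral_exp_mul_Ioi (a := -r) (by linarith) 0
    have : ∀ t : ℝ, -t * r = -r * t := fun t => by ring
    simp only [this]
    rw [← ofReal_integral_eq_lintegral_ofReal hI (ae_of_all _ fun x => (Real.exp_pos _).le), hv,
      ← ENNReal.ofReal_inv_of_pos hr]
    simp

theorem lintegral_Ioi_one_add_two_mul_rpow {b : ℝ} (hb : 0 < b) :
    ∫⁻ t in Set.Ioi (0 : ℝ), ENNReal.ofReal ((1 + 2 * t) ^ (-(b + 2) / 2 : ℝ)) =
      ENNReal.ofReal (1 / b) := by
  have hderiv : ∀ t ∈ Set.Ioi (0 : ℝ), HasDerivAt (fun t : ℝ => -(1 / b) * (1 + 2 * t) ^ (-b / 2))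
      ((1 + 2 * t) ^ (-(b + 2) / 2 : ℝ)) t := by
    intro t ht
    have ht : 0 < t := ht
    have h1 : HasDerivAt (fun t : ℝ => 1 + 2 * t) 2 t := by
      simpa using ((hasDerivAt_id t).const_mul 2).const_add 1
    have h2 := (h1.rpow_const (p := -b / 2) (Or.inl (by positivity))).const_mul (-(1 / b))
    rw [show -b / 2 - 1 = -(b + 2) / 2 by ring] at h2
    refine h2.congr_deriv ?_
    field_simp
  have hcont : ContinuousWithinAt (fun t : ℝ => -(1 / b) * (1 + 2 * t) ^ (-b / 2))
      (Set.Ici 0) 0 := by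
    apply ContinuousAt.continuousWithinAt
    apply ContinuousAt.mul continuousAt_const
    exact ContinuousAt.rpow_const (by fun_prop) (Or.inl (by norm_num))
  have hlim : Tendsto (fun t : ℝ => -(1 / b) * (1 + 2 * t) ^ (-b / 2)) atTop (nhds 0) := by
    rw [show (0 : ℝ) = -(1 / b) * 0 by ring]
    apply Tendsto.const_mul
    rw [show -b / 2 = -(b / 2) by ring]
    exact (tendsto_rpow_neg_atTop (by positivity)).comp
      (tendsto_atTop_add_const_left _ _ (tendsto_id.const_mul_atTop (by norm_num)))
  have hnn : ∀ t ∈ Set.Ioi (0 : ℝ), 0 ≤ (1 + 2 * t) ^ (-(b + 2) / 2 : ℝ) := fun t ht => by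
    have ht : 0 < t := ht
    positivity
  rw [← ofReal_integral_eq_lintegral_ofReal
    (integrableOn_Ioi_deriv_of_nonneg hcont hderiv hnn hlim)
    ((ae_restrict_iff' measurableSet_Ioi).2 (ae_of_all _ hnn)),
    integral_Ioi_of_hasDerivAt_of_nonneg hcont hderiv hnn hlim]
  simp

/-- Write `1/r` as the integral of `exp (-t r)` over `t > 0`, exchange integrals by Tonelli and
insert the Gaussian Laplace transform. Since `1 + 2t ≥ 1`, replacing the dimension by `b + 2` only
decreases the integrand. An inequality with free `b` also covers dimensions at most 2, where the
mean is infinite. -/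
theorem le_lintegral_inv_sq_norm_stdGaussian {b : ℝ} (hb : 0 < b)
    (hE : (Module.finrank ℝ E : ℝ) ≤ b + 2) :
    ENNReal.ofReal (1 / b) ≤ ∫⁻ z, (ENNReal.ofReal (‖z‖ ^ 2))⁻¹ ∂(stdGaussian E) := by
  calc ENNReal.ofReal (1 / b)
      = ∫⁻ t in Set.Ioi (0 : ℝ), ENNReal.ofReal ((1 + 2 * t) ^ (-(b + 2) / 2 : ℝ)) :=
        (lintegral_Ioi_one_add_two_mul_rpow hb).symm
    _ ≤ ∫⁻ t in Set.Ioi (0 : ℝ),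
          ENNReal.ofReal ((1 + 2 * t) ^ (-(Module.finrank ℝ E / 2) : ℝ)) := by
        refine setLIntegral_mono' measurableSet_Ioi fun t ht => ENNReal.ofReal_le_ofReal ?_
        have ht : 0 < t := ht
        exact Real.rpow_le_rpow_of_exponent_le (by linarith) (by linarith)
    _ = ∫⁻ t in Set.Ioi (0 : ℝ), ∫⁻ z, ENNReal.ofReal (Real.exp (-t * ‖z‖ ^ 2))
          ∂(stdGaussian E) := by
        refine setLIntegral_congr_fun measurableSet_Ioi fun t ht => ?_
        exact (lintegral_exp_neg_mul_sq_stdGaussian (le_of_lt ht)).symm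
    _ = ∫⁻ z : E, (∫⁻ t in Set.Ioi (0 : ℝ), ENNReal.ofReal (Real.exp (-t * ‖z‖ ^ 2)))
          ∂(stdGaussian E) := by
        rw [lintegral_lintegral_swap]
        exact Measurable.aemeasurable (by fun_prop)
    _ ≤ _ := lintegral_mono fun z => lintegral_Ioi_exp_neg_mul_le _ (by positivity)

/-- The characteristic functions agree, because pairing a projection with `t` in `W` is pairing the
original vector with `t`. -/
theorem stdGaussian_map_orthogonalProjection (W : Submodule ℝ E) :
    (stdGaussian E).map W.orthogonalProjectionOnto = stdGaussian W := by
  apply Measure.ext_of_charFun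
  ext t
  rw [charFun_stdGaussian, charFun_apply, integral_map (by fun_prop) (by fun_prop)]
  have : ∀ x : E, inner ℝ (W.orthogonalProjectionOnto x) t = inner ℝ x (t : E) := fun x => by
    simp
  simp only [this]
  rw [← charFun_apply, charFun_stdGaussian]
  simp

theorem le_lintegral_inv_sq_norm_proj {ι : Type*} [Fintype ι]
    (W : Submodule ℝ (EuclideanSpace ℝ ι)) {b : ℝ} (hb : 0 < b)
    (hW : (Fintype.card ι : ℝ) - Module.finrank ℝ W ≤ b + 2) :
    ENNReal.ofReal (2 / b) ≤ ∫⁻ g : ι → ℝ,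
      (ENNReal.ofReal (‖Wᗮ.orthogonalProjectionOnto (WithLp.toLp 2 g)‖ ^ 2))⁻¹
        ∂(Measure.pi fun _ => gaussianReal 0 (1 / 2)) := by
  have hscale : (Measure.pi fun _ : ι => gaussianReal 0 (1 / 2)) =
      (Measure.pi fun _ : ι => gaussianReal 0 1).map (fun x i => (√2)⁻¹ * x i) := by
    rw [Measure.pi_map_pi (fun i => by fun_prop)]
    congr 1
    ext1 i
    rw [gaussianReal_map_const_mul]
    congr 1
    · simp
    · ext
      simp
  have hfin : (Module.finrank ℝ Wᗮ : ℝ) ≤ b + 2 := by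
    have := Submodule.finrank_add_finrank_orthogonal W
    rw [finrank_euclideanSpace] at this
    have : (Module.finrank ℝ W : ℝ) + Module.finrank ℝ Wᗮ = Fintype.card ι := by exact_mod_cast this
    linarith
  have key := le_lintegral_inv_sq_norm_stdGaussian hb hfin
  rw [← stdGaussian_map_orthogonalProjection, lintegral_map (by fun_prop) (by fun_prop),
    ← map_pi_eq_stdGaussian, lintegral_map (by fun_prop) (by fun_prop)] at key
  rw [hscale, lintegral_map (by fun_prop) (by fun_prop)]
  have hnorm : ∀ x : ι → ℝ,
      (ENNReal.ofReal (‖Wᗮ.orthogonalProjectionOnto (WithLp.toLp 2 fun i => (√2)⁻¹ * x i)‖ ^ 2))⁻¹ =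
      ENNReal.ofReal 2 * (ENNReal.ofReal (‖Wᗮ.orthogonalProjectionOnto (WithLp.toLp 2 x)‖ ^ 2))⁻¹ := by
    intro x
    rw [show (WithLp.toLp 2 fun i => (√2)⁻¹ * x i) = (√2)⁻¹ • WithLp.toLp 2 x from rfl, map_smul,
      norm_smul, mul_pow, ENNReal.ofReal_mul (by positivity), ENNReal.mul_inv (by simp) (by simp)]
    congr 1
    rw [← ENNReal.ofReal_inv_of_pos (by simp)]
    simp
  simp only [hnorm]
  rw [lintegral_const_mul _ (by fun_prop), show 2 / b = 2 * (1 / b) by ring,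
    ENNReal.ofReal_mul (by norm_num)]
  gcongr

end Gaussian

/-! ### Resampling one coordinate of a product measure. -/

section Update

variable {ι : Type*} [Fintype ι] [DecidableEq ι] {X : ι → Type*} [∀ i, MeasurableSpace (X i)]
  (μ : ∀ i, Measure (X i)) [∀ i, IsProbabilityMeasure (μ i)]

/-- This plays the role of conditioning on all users except `k`. -/
theorem lintegral_pi_eq_lintegral_update {f : (∀ i, X i) → ℝ≥0∞} (hf : Measurable f) (k : ι) :
    ∫⁻ x, f x ∂(Measure.pi μ) =
      ∫⁻ x, (∫⁻ y, f (Function.update x k y) ∂(μ k)) ∂(Measure.pi μ) := by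
  have hm := hf.lmarginal μ (s := {k})
  rw [lmarginal_singleton] at hm
  refine lintegral_eq_of_lmarginal_eq {k} hf hm ?_
  simp only [lmarginal_singleton, Function.update_idem, lintegral_const, measure_univ, mul_one]

theorem ae_pi_iff_ae_update {p : (∀ i, X i) → Prop} (hp : MeasurableSet {x | p x}) (k : ι) :
    (∀ᵐ x ∂(Measure.pi μ), p x) ↔
      ∀ᵐ x ∂(Measure.pi μ), ∀ᵐ y ∂(μ k), p (Function.update x k y) := by
  have hc : Measurable (({x | p x}ᶜ).indicator (1 : (∀ i, X i) → ℝ≥0∞)) :=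
    measurable_one.indicator hp.compl
  have hm := hc.lmarginal μ (s := {k})
  rw [lmarginal_singleton] at hm
  have hu : ∀ x, Measurable fun y => ({x | p x}ᶜ).indicator (1 : (∀ i, X i) → ℝ≥0∞)
      (Function.update x k y) := fun x => hc.comp (measurable_update x)
  have h := lintegral_pi_eq_lintegral_update μ hc k
  have h1 : (∀ᵐ x ∂(Measure.pi μ), p x) ↔
      ∫⁻ x, ({x | p x}ᶜ).indicator (1 : (∀ i, X i) → ℝ≥0∞) x ∂(Measure.pi μ) = 0 := by
    rw [lintegral_indicator_one hp.compl, ae_iff]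
    rfl
  rw [h1, h, lintegral_eq_zero_iff hm]
  refine eventually_congr (Eventually.of_forall fun x => ?_)
  simp only [Pi.zero_apply]
  rw [lintegral_eq_zero_iff (hu x)]
  refine eventually_congr (Eventually.of_forall fun y => ?_)
  simp

end Update

/-! ### Law and almost sure independence of the channel rows. -/

section Channel

instance : IsProbabilityMeasure stdComplexGaussian :=
  Measure.isProbabilityMeasure_map (by
    exact Complex.measurableEquivRealProd.symm.measurable.aemeasurable)

instance (K Nt : ℕ) : IsProbabilityMeasure (channelLaw K Nt) := by
  unfold channelLaw
  infer_instance

theorem stdComplexGaussian_apply {s : Set ℂ} (hs : MeasurableSet s) :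
    stdComplexGaussian s = ((gaussianReal 0 (1 / 2)).prod (gaussianReal 0 (1 / 2)))
      {p | (⟨p.1, p.2⟩ : ℂ) ∈ s} :=
  Measure.map_apply Complex.measurableEquivRealProd.symm.measurable hs

theorem stdComplexGaussian_singleton (w : ℂ) : stdComplexGaussian {w} = 0 := by
  have : {p : ℝ × ℝ | (⟨p.1, p.2⟩ : ℂ) ∈ ({w} : Set ℂ)} = {w.re} ×ˢ {w.im} := by
    ext p
    simp [Complex.ext_iff, Prod.ext_iff]
  have hn : NullSingletonClass (gaussianReal 0 (1 / 2)) :=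
    nullSingletonClass_gaussianReal (by simp)
  rw [stdComplexGaussian_apply (measurableSet_singleton w), this, Measure.prod_prod,
    measure_singleton, zero_mul]

variable {K N : ℕ}

/-- The user to which a real-valued index belongs. -/
def user : Fin K ⊕ Fin K → Fin K := Sum.elim id id

/-- The row of index `i` of the real-valued channel matrix, as a function of the complex channel
vector of the user of `i`. -/
def realRow (i : Fin K ⊕ Fin K) (z : Fin N → ℂ) : Fin N ⊕ Fin N → ℝ :=
  Sum.elim (fun _ => Sum.elim (fun n => (z n).re) (fun n => -(z n).im))
    (fun _ => Sum.elim (fun n => (z n).im) (fun n => (z n).re)) i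

theorem realChannel_apply (h : Fin K → Fin N → ℂ) (i : Fin K ⊕ Fin K) :
    realChannel h i = realRow i (h (user i)) := by
  ext j
  rcases i with i | i <;> rcases j with j | j <;> rfl

theorem measurable_realRow (i : Fin K ⊕ Fin K) : Measurable (realRow (N := N) i) := by
  refine measurable_pi_iff.2 fun j => ?_
  rcases i with i | i <;> rcases j with j | j <;> simp only [realRow, Sum.elim_inl, Sum.elim_inr] <;>
    fun_prop

/-- Each real row lists the real and imaginary parts of one complex vector up to order and sign, and
the centred Gaussian is symmetric. -/
theorem map_realRow (i : Fin K ⊕ Fin K) :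
    (Measure.pi fun _ : Fin N => stdComplexGaussian).map (realRow i) =
      Measure.pi fun _ => gaussianReal 0 (1 / 2) := by
  refine (Measure.pi_eq fun s hs => ?_).symm
  rw [Measure.map_apply (measurable_realRow i) (MeasurableSet.univ_pi hs), Fintype.prod_sum_type,
    ← Finset.prod_mul_distrib]
  have hneg : ∀ t : Set ℝ, MeasurableSet t →
      gaussianReal 0 (1 / 2) (-t) = gaussianReal 0 (1 / 2) t := fun t ht => by
    have := gaussianReal_map_neg (μ := 0) (v := 1 / 2)
    rw [neg_zero] at this
    conv_rhs => rw [← this, Measure.map_apply measurable_neg ht]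
    rfl
  rcases i with i | i
  · have : realRow (.inl i) ⁻¹' Set.univ.pi s =
        Set.univ.pi fun n : Fin N => {w : ℂ | w.re ∈ s (.inl n) ∧ -w.im ∈ s (.inr n)} := by
      ext z
      simp [realRow, Set.mem_pi, forall_and]
    rw [this, Measure.pi_pi]
    refine Finset.prod_congr rfl fun n _ => ?_
    rw [stdComplexGaussian_apply, ← hneg _ (hs (.inr n)), ← Measure.prod_prod]
    · rfl
    · exact (Complex.measurable_re (hs _)).inter (Complex.measurable_im.neg (hs _))
  · have : realRow (.inr i) ⁻¹' Set.univ.pi s =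
        Set.univ.pi fun n : Fin N => {w : ℂ | w.im ∈ s (.inl n) ∧ w.re ∈ s (.inr n)} := by
      ext z
      simp [realRow, Set.mem_pi, forall_and]
    rw [this, Measure.pi_pi]
    refine Finset.prod_congr rfl fun n _ => ?_
    rw [stdComplexGaussian_apply, mul_comm, ← Measure.prod_prod]
    · congr 1
      ext p
      simp [and_comm]
    · exact (Complex.measurable_im (hs _)).inter (Complex.measurable_re (hs _))

/-- A proper subspace lies in the kernel of a nonzero functional, which depends on some coordinate
`j`. With the other coordinates fixed, at most one value of coordinate `j` is a zero, and points are
null. -/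
theorem pi_stdComplexGaussian_submodule {V : Submodule ℂ (Fin N → ℂ)} (hV : V ≠ ⊤) :
    ∀ᵐ z ∂(Measure.pi fun _ : Fin N => stdComplexGaussian), z ∉ V := by
  obtain ⟨f, hf0, hf⟩ := V.exists_le_ker_of_lt_top hV.lt_top
  obtain ⟨j, hj⟩ : ∃ j, f (Pi.single j 1) ≠ 0 := by
    by_contra! hc
    exact hf0 (LinearMap.pi_ext' fun j => LinearMap.ext_ring (by simpa using hc j))
  suffices ∀ᵐ z ∂(Measure.pi fun _ : Fin N => stdComplexGaussian), f z ≠ 0 from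
    this.mono fun z hz hzV => hz (hf hzV)
  have hcont : Continuous f := f.continuous_of_finiteDimensional
  have hmeas : MeasurableSet {z | f z ≠ 0} :=
    (measurableSet_eq_fun hcont.measurable measurable_const).compl
  rw [ae_pi_iff_ae_update _ hmeas j]
  refine ae_of_all _ fun z => ?_
  have hsub : {w : ℂ | f (Function.update z j w) = 0} ⊆
      {-f (Function.update z j 0) / f (Pi.single j 1)} := by
    intro w hw
    have hw : f (Function.update z j w) = 0 := hw
    have hdec : Function.update z j w = Function.update z j 0 + w • Pi.single j 1 := by
      ext n
      rcases eq_or_ne n j with rfl | hn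
      · simp
      · simp [hn]
    rw [hdec, map_add, map_smul, smul_eq_mul] at hw
    rw [Set.mem_singleton_iff, eq_div_iff hj]
    linear_combination hw
  rw [ae_iff]
  simp only [not_not, ne_eq]
  exact measure_mono_null hsub (stdComplexGaussian_singleton _)

theorem measurableSet_linearIndepOn (S : Set (Fin K)) :
    MeasurableSet {h : Fin K → Fin N → ℂ | LinearIndepOn ℂ h S} := by
  have : Continuous fun (h : Fin K → Fin N → ℂ) (i : S) => h i := by fun_prop
  exact (isOpen_setOfPred_linearIndependent.preimage this).measurableSet

theorem ae_linearIndepOn (hKN : K ≤ N) (S : Finset (Fin K)) :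
    ∀ᵐ h ∂(channelLaw K N), LinearIndepOn ℂ h (S : Set (Fin K)) := by
  induction S using Finset.induction_on with
  | empty => simp
  | insert k S hk ih =>
    unfold channelLaw at ih ⊢
    rw [ae_pi_iff_ae_update _ (measurableSet_linearIndepOn _) k]
    filter_upwards [ih] with h hh
    have hV : Submodule.span ℂ (h '' S) ≠ ⊤ := by
      intro htop
      have h1 := finrank_span_finset_le_card (R := ℂ) (S.image h)
      rw [Finset.coe_image, Set.finrank, htop, finrank_top, Module.finrank_fin_fun] at h1
      have h2 := (Finset.card_image_le (s := S) (f := h))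
      have h3 := Finset.card_lt_univ_of_notMem hk
      rw [Fintype.card_fin] at h3
      omega
    filter_upwards [pi_stdComplexGaussian_submodule hV] with y hy
    have heq : Set.EqOn h (Function.update h k y) S := fun i hi => by
      have : i ≠ k := fun e => hk (e ▸ hi)
      simp [this]
    rw [Finset.coe_insert]
    refine (hh.congr heq).insert ?_
    rw [Function.update_self, ← heq.image_eq]
    exact hy

theorem ae_linearIndependent (hKN : K ≤ N) :
    ∀ᵐ h ∂(channelLaw K N), LinearIndependent ℂ h := by
  simpa using ae_linearIndepOn hKN Finset.univ

theorem linearIndependent_realRow {h : Fin K → Fin N → ℂ} (hh : LinearIndependent ℂ h) :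
    LinearIndependent ℝ (fun i => realRow i (h (user i))) := by
  rw [Fintype.linearIndependent_iff] at hh ⊢
  intro g hg
  -- With these complex coefficients, the two halves of the real relation are the real part and
  -- minus the imaginary part of a complex relation.
  have key := hh (fun k => ⟨g (.inl k), -g (.inr k)⟩) (by
    ext n
    have h1 := congrFun hg (.inl n)
    have h2 := congrFun hg (.inr n)
    simp only [Fintype.sum_sum_type, realRow, user,
      Finset.sum_apply, Pi.smul_apply, Sum.elim_inl, Sum.elim_inr, smul_eq_mul, id,
      Pi.zero_apply, ← Finset.sum_add_distrib] at h1 h2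
    apply Complex.ext
    · simp only [Finset.sum_apply, Pi.smul_apply, smul_eq_mul, Complex.re_sum, Complex.mul_re,
        Pi.zero_apply, Complex.zero_re]
      rw [← h1]
      exact Finset.sum_congr rfl fun k _ => by ring
    · simp only [Finset.sum_apply, Pi.smul_apply, smul_eq_mul, Complex.im_sum, Complex.mul_im,
        Pi.zero_apply, Complex.zero_im]
      rw [← neg_eq_zero, ← h2, ← Finset.sum_neg_distrib]
      exact Finset.sum_congr rfl fun k _ => by ring)
  rintro (k | k)
  · simpa using congrArg Complex.re (key k)
  · simpa using congrArg Complex.im (key k)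

end Channel

/-! ### Inverses of positive definite matrices. -/

section PosDef

variable {n m : Type*} [Fintype n] [Fintype m] [DecidableEq n] [DecidableEq m]

theorem dotProduct_mulVec_comm_of_isHermitian {n : Type*} [Fintype n] {A : Matrix n n ℝ} (hA : A.IsHermitian)
    (x y : n → ℝ) : x ⬝ᵥ A *ᵥ y = y ⬝ᵥ A *ᵥ x := by
  have hT : Aᵀ = A := by simpa [Matrix.conjTranspose_eq_transpose_of_trivial] using hA.eq
  rw [Matrix.dotProduct_mulVec, dotProduct_comm, ← Matrix.mulVec_transpose, hT]

/-- Restricting a positive definite form to fewer coordinates decreases the inverse form. -/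
theorem dotProduct_inv_transpose_mul_mul_le {A : Matrix n n ℝ} (hA : A.PosDef)
    {P : Matrix n m ℝ} (hP : (Pᵀ * A * P).PosDef) (s : n → ℝ) :
    (Pᵀ *ᵥ s) ⬝ᵥ (Pᵀ * A * P)⁻¹ *ᵥ (Pᵀ *ᵥ s) ≤ s ⬝ᵥ A⁻¹ *ᵥ s := by
  set B := Pᵀ * A * P with hB
  set t := Pᵀ *ᵥ s with ht
  set v := B⁻¹ *ᵥ t with hv
  have hBv : B *ᵥ v = t := by
    rw [hv, Matrix.mulVec_mulVec, Matrix.mul_nonsing_inv _ ((Matrix.isUnit_iff_isUnit_det _).1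
      hP.isUnit), Matrix.one_mulVec]
  have hAinv : A⁻¹ *ᵥ (A *ᵥ (P *ᵥ v)) = P *ᵥ v := by
    rw [Matrix.mulVec_mulVec, Matrix.nonsing_inv_mul _ ((Matrix.isUnit_iff_isUnit_det _).1
      hA.isUnit), Matrix.one_mulVec]
  -- The vector `A P v` is the projection of `s` onto the range of `A P` in the `A⁻¹` inner product;
  -- the residual has nonnegative square norm.
  have h0 := hA.inv.posSemidef.dotProduct_mulVec_nonneg (s - A *ᵥ (P *ᵥ v))
  rw [star_trivial, Matrix.mulVec_sub, hAinv, sub_dotProduct, dotProduct_sub, dotProduct_sub,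
    dotProduct_mulVec_comm_of_isHermitian hA.inv.isHermitian (A *ᵥ (P *ᵥ v)) s, hAinv] at h0
  have h1 : s ⬝ᵥ P *ᵥ v = t ⬝ᵥ v := by
    rw [ht, Matrix.dotProduct_mulVec, Matrix.mulVec_transpose]
  have h2 : (A *ᵥ (P *ᵥ v)) ⬝ᵥ P *ᵥ v = t ⬝ᵥ v := by
    rw [← hBv, hB, Matrix.dotProduct_mulVec, ← Matrix.mulVec_transpose, Matrix.mulVec_mulVec,
      Matrix.mulVec_mulVec, Matrix.mul_assoc]
  rw [h1, h2] at h0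
  linarith

/-- Cauchy–Schwarz in the `A` inner product for `u` and column `i` of `A⁻¹`, whose inner product is
`u i`. Any trial vector `u` thus bounds the diagonal entry from below. -/
theorem one_le_inv_diag_mul {A : Matrix n n ℝ} (hA : A.PosDef) {i : n} {u : n → ℝ}
    (hu : u i = 1) : 1 ≤ A⁻¹ i i * (u ⬝ᵥ A *ᵥ u) := by
  set c := A⁻¹ i i with hc
  have hcpos : 0 < c := hA.inv.diag_pos
  set e := A⁻¹ *ᵥ Pi.single i 1 with he
  have hAe : A *ᵥ e = Pi.single i 1 := by
    rw [he, Matrix.mulVec_mulVec, Matrix.mul_nonsing_inv _ ((Matrix.isUnit_iff_isUnit_det _).1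
      hA.isUnit), Matrix.one_mulVec]
  have hei : e i = c := by simp [he, hc]
  have h0 := hA.posSemidef.dotProduct_mulVec_nonneg (c • u - e)
  rw [star_trivial, Matrix.mulVec_sub, Matrix.mulVec_smul, hAe, sub_dotProduct, dotProduct_sub,
    dotProduct_sub, dotProduct_smul, smul_dotProduct, smul_dotProduct, dotProduct_smul,
    dotProduct_mulVec_comm_of_isHermitian hA.isHermitian e u, hAe, dotProduct_single_one,
    dotProduct_single_one, hu, hei] at h0
  simp only [smul_eq_mul, mul_one] at h0
  have h1 : 0 ≤ c * (c * (u ⬝ᵥ A *ᵥ u) - 1) := by linarith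
  linarith [nonneg_of_mul_nonneg_right h1 hcpos]

theorem measurable_inv_apply {α : Type*} [MeasurableSpace α] {A : α → Matrix n n ℝ}
    (hA : ∀ i j, Measurable fun x => A x i j) (i j : n) : Measurable fun x => (A x)⁻¹ i j := by
  have hdet : ∀ {B : α → Matrix n n ℝ}, (∀ i j, Measurable fun x => B x i j) →
      Measurable fun x => (B x).det := fun hB => by
    simp only [Matrix.det_apply]
    exact Finset.measurable_sum _ fun σ _ =>
      (Finset.measurable_prod _ fun k _ => hB _ _).const_smul _
  simp only [Matrix.inv_def, Ring.inverse_eq_inv', Matrix.smul_apply, smul_eq_mul,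
    Matrix.adjugate_apply]
  refine (hdet hA).inv.mul (hdet fun k l => ?_)
  simp only [Matrix.updateRow_apply]
  split_ifs
  · exact measurable_const
  · exact hA k l

end PosDef

/-! ### Gram matrices of selected rows and their mean inverse diagonal. -/

section Gram

variable {K N : ℕ}

/-- The Gram matrix of the rows of the real-valued channel with index in `I`. -/
def gram (h : Fin K → Fin N → ℂ) (I : Finset (Fin K ⊕ Fin K)) : Matrix I I ℝ :=
  (realChannel h * (realChannel h)ᵀ).submatrix (↑) (↑)

theorem measurable_gram_inv (I : Finset (Fin K ⊕ Fin K)) (i j : I) :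
    Measurable fun h : Fin K → Fin N → ℂ => (gram h I)⁻¹ i j := by
  refine measurable_inv_apply (fun i j => ?_) i j
  simp only [gram, Matrix.submatrix_apply, Matrix.mul_apply, Matrix.transpose_apply,
    realChannel_apply]
  refine Finset.measurable_sum _ fun l _ => ?_
  exact ((measurable_pi_apply l).comp ((measurable_realRow _).comp (measurable_pi_apply _))).mul
    ((measurable_pi_apply l).comp ((measurable_realRow _).comp (measurable_pi_apply _)))

theorem posDef_realChannel {h : Fin K → Fin N → ℂ} (hh : LinearIndependent ℂ h) :
    (realChannel h * (realChannel h)ᵀ).PosDef := by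
  have := Matrix.PosDef.mul_conjTranspose_self (realChannel h) (by
    rw [Matrix.vecMul_injective_iff]
    convert linearIndependent_realRow hh using 2 with i
    exact realChannel_apply h i)
  rwa [Matrix.conjTranspose_eq_transpose_of_trivial] at this

theorem posDef_gram {h : Fin K → Fin N → ℂ} (hh : LinearIndependent ℂ h)
    (I : Finset (Fin K ⊕ Fin K)) : (gram h I).PosDef :=
  (posDef_realChannel hh).submatrix Subtype.val_injective

theorem sum_gram_inv_le_objective {h : Fin K → Fin N → ℂ} (hh : LinearIndependent ℂ h)
    (I : Finset (Fin K ⊕ Fin K)) (s : Fin K ⊕ Fin K → ℝ) :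
    ∑ i : I, ∑ j : I, s i * s j * (gram h I)⁻¹ i j ≤ objective h s := by
  let P : Matrix (Fin K ⊕ Fin K) I ℝ := (1 : Matrix _ _ ℝ).submatrix id Subtype.val
  have hB : Pᵀ * (realChannel h * (realChannel h)ᵀ) * P = gram h I := by
    ext i j
    simp [P, gram, Matrix.mul_apply, Matrix.one_apply]
  have hs : Pᵀ *ᵥ s = fun i : I => s i := by
    ext i
    simp [P, Matrix.mulVec, dotProduct, Matrix.one_apply]
  have := dotProduct_inv_transpose_mul_mul_le (posDef_realChannel hh) (P := P)
    (by rw [hB]; exact posDef_gram hh I) s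
  rw [hB, hs] at this
  refine le_trans (le_of_eq ?_) this
  simp only [dotProduct, Matrix.mulVec, Finset.mul_sum]
  exact Finset.sum_congr rfl fun i _ => Finset.sum_congr rfl fun j _ => by ring

/-- The row of index `i` as a vector of Euclidean space. -/
def rowVec (h : Fin K → Fin N → ℂ) (i : Fin K ⊕ Fin K) : EuclideanSpace ℝ (Fin N ⊕ Fin N) :=
  WithLp.toLp 2 (realRow i (h (user i)))

/-- The span of the rows with index in `I` that belong to other users than `i` does. -/
def otherSpan (h : Fin K → Fin N → ℂ) (I : Finset (Fin K ⊕ Fin K)) (i : Fin K ⊕ Fin K) :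
    Submodule ℝ (EuclideanSpace ℝ (Fin N ⊕ Fin N)) :=
  Submodule.span ℝ (Set.range fun j : {j : I // user (j : Fin K ⊕ Fin K) ≠ user i} => rowVec h j.1)

theorem otherSpan_update (h : Fin K → Fin N → ℂ) (I : Finset (Fin K ⊕ Fin K)) (i : Fin K ⊕ Fin K)
    (y : Fin N → ℂ) : otherSpan (Function.update h (user i) y) I i = otherSpan h I i := by
  unfold otherSpan
  congr 2
  ext1 j
  simp [rowVec, Function.update_of_ne j.2]

/-- A user owns only two real indices, so at most two rows are excluded from the span. -/
theorem card_le_finrank_otherSpan {h : Fin K → Fin N → ℂ} (hh : LinearIndependent ℂ h)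
    (I : Finset (Fin K ⊕ Fin K)) (i : Fin K ⊕ Fin K) :
    I.card ≤ Module.finrank ℝ (otherSpan h I i) + 2 := by
  have hli : LinearIndependent ℝ (rowVec h) :=
    (linearIndependent_realRow hh).map' (WithLp.linearEquiv 2 ℝ _).symm.toLinearMap
      (LinearEquiv.ker _)
  have hli' : LinearIndependent ℝ
      (fun j : {j : I // user (j : Fin K ⊕ Fin K) ≠ user i} => rowVec h j.1) :=
    hli.comp _ (Subtype.val_injective.comp Subtype.val_injective)
  rw [otherSpan, finrank_span_eq_card hli', Fintype.card_subtype]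
  have h1 := Finset.card_filter_add_card_filter_not (s := (Finset.univ : Finset I))
    (fun j : I => user (j : Fin K ⊕ Fin K) ≠ user i)
  have h2 : (Finset.univ.filter fun j : I => ¬ user (j : Fin K ⊕ Fin K) ≠ user i).card ≤
      ({.inl (user i), .inr (user i)} : Finset (Fin K ⊕ Fin K)).card := by
    refine Finset.card_le_card_of_injOn Subtype.val (fun j hj => ?_) Subtype.val_injective.injOn
    have hj : user (j : Fin K ⊕ Fin K) = user i := by simpa using hj
    rw [← hj]
    rcases (j : Fin K ⊕ Fin K) with j | j <;> simp [user]
  have h3 : ({.inl (user i), .inr (user i)} : Finset (Fin K ⊕ Fin K)).card ≤ 2 :=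
    Finset.card_le_two
  rw [Finset.card_univ, Fintype.card_coe] at h1
  omega

theorem inv_sq_norm_proj_le_gram_inv {h : Fin K → Fin N → ℂ} (hh : LinearIndependent ℂ h)
    (I : Finset (Fin K ⊕ Fin K)) (i : I) :
    (ENNReal.ofReal (‖(otherSpan h I i)ᗮ.orthogonalProjectionOnto (rowVec h i)‖ ^ 2))⁻¹ ≤
      ENNReal.ofReal ((gram h I)⁻¹ i i) := by
  set W := otherSpan h I i with hW
  have hmem : ((W.orthogonalProjectionOnto (rowVec h i) : W) :
      EuclideanSpace ℝ (Fin N ⊕ Fin N)) ∈ otherSpan h I i := Submodule.coe_mem _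
  rw [otherSpan, Submodule.mem_span_range_iff_exists_fun] at hmem
  obtain ⟨c, hc⟩ := hmem
  classical
  -- Coefficients of the residual of row `i` modulo `W`: one at `i`, zero at the companion row if
  -- present, minus the projection coefficients elsewhere.
  let u : I → ℝ := fun j => if hj : user (j : Fin K ⊕ Fin K) ≠ user i then -c ⟨j, hj⟩ else
    if j = i then 1 else 0
  have hui : u i = 1 := by simp [u]
  have hsum : ∑ j, u j • rowVec h j = Wᗮ.orthogonalProjectionOnto (rowVec h i) := by
    have hproj : ((Wᗮ.orthogonalProjectionOnto (rowVec h i) : Wᗮ) :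
        EuclideanSpace ℝ (Fin N ⊕ Fin N)) =
        rowVec h i - W.orthogonalProjectionOnto (rowVec h i) := by
      rw [Submodule.orthogonalProjectionOnto_orthogonal]
      rfl
    rw [hproj, ← hc, ← Fintype.sum_subtype_add_sum_subtype
      (fun j : I => user (j : Fin K ⊕ Fin K) ≠ user i), add_comm, sub_eq_add_neg, ← Finset.sum_neg_distrib]
    congr 1
    · rw [Finset.sum_eq_single ⟨i, by simp⟩]
      · simp [u]
      · rintro ⟨j, hj⟩ _ hji
        have hji : j ≠ i := fun e => hji (Subtype.ext e)
        simp only [u, dif_neg hj, if_neg hji, zero_smul]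
      · simp
    · refine Finset.sum_congr rfl fun j _ => ?_
      simp only [u, dif_pos j.2, neg_smul]
  have hquad : u ⬝ᵥ gram h I *ᵥ u =
      ‖Wᗮ.orthogonalProjectionOnto (rowVec h i)‖ ^ 2 := by
    rw [← Submodule.norm_coe, ← hsum, ← real_inner_self_eq_norm_sq, sum_inner]
    simp only [inner_sum, real_inner_smul_left, real_inner_smul_right, dotProduct, Matrix.mulVec,
      Finset.mul_sum]
    refine Finset.sum_congr rfl fun j _ => Finset.sum_congr rfl fun k _ => ?_
    have : gram h I j k = inner ℝ (rowVec h j) (rowVec h k) := by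
      simp [gram, Matrix.mul_apply, realChannel_apply, rowVec, PiLp.inner_apply, mul_comm]
    rw [this]
    ring
  have hone := one_le_inv_diag_mul (posDef_gram hh I) hui
  rw [hquad] at hone
  rw [ENNReal.inv_le_iff_le_mul (by simp) (by simp), mul_comm,
    ← ENNReal.ofReal_mul (posDef_gram hh I).inv.diag_pos.le]
  simpa using hone

theorem le_lintegral_gram_inv (hKN : K ≤ N) (I : Finset (Fin K ⊕ Fin K)) (i : I) {b : ℝ}
    (hb : 0 < b) (hI : 2 * (N : ℝ) - I.card ≤ b) :
    ENNReal.ofReal (2 / b) ≤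
      ∫⁻ h : Fin K → Fin N → ℂ, ENNReal.ofReal ((gram h I)⁻¹ i i) ∂(channelLaw K N) := by
  have hae := ae_linearIndependent hKN
  have hae' := hae
  have hmeas : MeasurableSet {h : Fin K → Fin N → ℂ | LinearIndependent ℂ h} :=
    isOpen_setOfPred_linearIndependent.measurableSet
  unfold channelLaw at hae hae' ⊢
  rw [ae_pi_iff_ae_update _ hmeas (user i)] at hae'
  rw [lintegral_pi_eq_lintegral_update _ (measurable_gram_inv I i i).ennreal_ofReal (user i)]
  calc ENNReal.ofReal (2 / b)
      = ∫⁻ _ : Fin K → Fin N → ℂ, ENNReal.ofReal (2 / b)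
        ∂(Measure.pi fun _ => Measure.pi fun _ => stdComplexGaussian) := by simp
    _ ≤ _ := lintegral_mono_ae ?_
  filter_upwards [hae, hae'] with h hh hy
  have hdim : (Fintype.card (Fin N ⊕ Fin N) : ℝ) - Module.finrank ℝ (otherSpan h I i) ≤ b + 2 := by
    have : (I.card : ℝ) ≤ Module.finrank ℝ (otherSpan h I i) + 2 := by
      exact_mod_cast card_le_finrank_otherSpan hh I i
    simp only [Fintype.card_sum, Fintype.card_fin, Nat.cast_add]
    linarith
  refine (le_lintegral_inv_sq_norm_proj (otherSpan h I i) hb hdim).trans ?_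
  rw [← map_realRow (i : Fin K ⊕ Fin K), lintegral_map (by fun_prop) (measurable_realRow _)]
  refine lintegral_mono_ae (hy.mono fun y hy => ?_)
  have := inv_sq_norm_proj_le_gram_inv hy I i
  rwa [otherSpan_update, rowVec, Function.update_self] at this

end Gram

/-! ### Averages over the messages. -/

section Message

/-- The message symbols of the real-valued representation, as a bijection. -/
def messageEquiv (K L : ℕ) : (Fin K → Fin (L ^ 2)) ≃ (Fin K ⊕ Fin K → Fin L) :=
  (((Equiv.refl (Fin K)).arrowCongr ((finCongr (pow_two L)).trans
    (finProdFinEquiv.symm.trans (Equiv.prodComm _ _)))).trans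
      (Equiv.arrowProdEquivProdArrow (Fin K) (fun _ => Fin L) (fun _ => Fin L))).trans
        (Equiv.sumArrowEquivProdArrow _ _ _).symm

theorem coe_messageEquiv {K L : ℕ} (m : Fin K → Fin (L ^ 2)) (i : Fin K ⊕ Fin K) :
    (messageEquiv K L m i : ℕ) = realMessage m i := by
  rcases i with i | i <;> rfl

/-- The message law is a normalized finite sum of Dirac masses, and each `h ↦ (h, m)` is a
measurable embedding; the splitting therefore requires no measurability of `relaxedValue`. -/
theorem expectedRelaxedValue_eq (K Nt L : ℕ) :
    expectedRelaxedValue K Nt L = ((L : ℝ≥0∞) ^ (2 * K))⁻¹ *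
      ∑ m : Fin K → Fin (L ^ 2),
        ∫⁻ h : Fin K → Fin Nt → ℂ, ENNReal.ofReal (relaxedValue h m) ∂(channelLaw K Nt) := by
  have hlaw : messageLaw K L = ((L : ℝ≥0∞) ^ (2 * K))⁻¹ •
      Measure.sum fun m : Fin K → Fin (L ^ 2) => Measure.dirac m := by
    rw [messageLaw, ← uniformOn_pi, Set.pi_univ, uniformOn, ProbabilityTheory.cond,
      Measure.restrict_univ, ← Measure.count]
    congr 2
    simp [Measure.count_univ, pow_mul]
  rw [expectedRelaxedValue, hlaw, Measure.prod_smul_right, lintegral_smul_measure, smul_eq_mul,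
    Measure.prod_sum_right, lintegral_sum_measure, tsum_fintype]
  congr 1
  refine Finset.sum_congr rfl fun m _ => ?_
  rw [Measure.prod_dirac, (measurableEmbedding_prod_mk_right m).lintegral_map]

variable {L : ℕ}

/-- The PAM point of a symbol. -/
def pam (a : Fin L) : ℝ := 2 * (a : ℝ) - (L : ℝ) + 1

/-- The indices of the interior symbols. -/
def interiorIndex {ι : Type*} [Fintype ι] (ℓ : ι → Fin L) : Finset ι :=
  Finset.univ.filter fun i => 1 ≤ (ℓ i : ℕ) ∧ (ℓ i : ℕ) + 2 ≤ L

theorem mem_interiorIndex {ι : Type*} [Fintype ι] {ℓ : ι → Fin L} {i : ι} :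
    i ∈ interiorIndex ℓ ↔ 1 ≤ (ℓ i : ℕ) ∧ (ℓ i : ℕ) + 2 ≤ L := by
  simp [interiorIndex]

theorem pam_rev (a : Fin L) : pam a.rev = -pam a := by
  have h : ((a.rev : ℕ) : ℝ) = (L : ℝ) - ((a : ℝ) + 1) := by
    rw [Fin.val_rev, Nat.cast_sub a.2]
    push_cast
    ring
  rw [pam, pam, h]
  ring

theorem le_relaxedValue {K N : ℕ} {h : Fin K → Fin N → ℂ} (hh : LinearIndependent ℂ h)
    (m : Fin K → Fin (L ^ 2)) :
    ∑ i : interiorIndex (messageEquiv K L m), ∑ j : interiorIndex (messageEquiv K L m),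
      pam (messageEquiv K L m i) * pam (messageEquiv K L m j) *
        (gram h (interiorIndex (messageEquiv K L m)))⁻¹ i j ≤ relaxedValue h m := by
  refine le_csInf (Set.Nonempty.image _ ⟨fun i => 2 * (realMessage m i : ℝ) - (L : ℝ) + 1,
    fun i _ => rfl⟩) ?_
  rintro _ ⟨s, hs, rfl⟩
  refine le_trans (le_of_eq ?_)
    (sum_gram_inv_le_objective hh (interiorIndex (messageEquiv K L m)) s)
  have hsi : ∀ i : interiorIndex (messageEquiv K L m), s i = pam (messageEquiv K L m i) := by
    rintro ⟨i, hi⟩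
    rw [mem_interiorIndex, coe_messageEquiv] at hi
    rw [hs i hi, pam, coe_messageEquiv]
  exact Finset.sum_congr rfl fun i _ => Finset.sum_congr rfl fun j _ => by rw [hsi, hsi]

variable {ι : Type*} [Fintype ι] [DecidableEq ι]

theorem interiorIndex_update_rev (ℓ : ι → Fin L) (i : ι) :
    interiorIndex (Function.update ℓ i (ℓ i).rev) = interiorIndex ℓ := by
  ext j
  rw [mem_interiorIndex, mem_interiorIndex]
  rcases eq_or_ne j i with rfl | hj
  · rw [Function.update_self, Fin.val_rev]
    omega
  · rw [Function.update_of_ne hj]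

/-- Reversing symbol `i` is an involution on messages that negates the summand. -/
theorem sum_pam_mul_pam_mul_eq_zero (F : Finset ι → ℝ) {i j : ι} (hij : i ≠ j) :
    ∑ ℓ : ι → Fin L, pam (ℓ i) * pam (ℓ j) * F (interiorIndex ℓ) = 0 := by
  have hinv : Function.Involutive fun ℓ : ι → Fin L => Function.update ℓ i (ℓ i).rev := fun ℓ => by
    simp
  have := Equiv.sum_comp hinv.toPerm
    fun ℓ : ι → Fin L => pam (ℓ i) * pam (ℓ j) * F (interiorIndex ℓ)
  simp only [Function.Involutive.coe_toPerm, interiorIndex_update_rev, Function.update_self,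
    Function.update_of_ne hij.symm, pam_rev, neg_mul, Finset.sum_neg_distrib] at this
  linarith

/-- Averaging over the messages leaves only the diagonal of the quadratic forms. -/
theorem sum_quadratic_eq_sum_diag (A : ∀ I : Finset ι, Matrix I I ℝ) :
    ∑ ℓ : ι → Fin L, ∑ i : interiorIndex ℓ, ∑ j : interiorIndex ℓ,
      pam (ℓ i) * pam (ℓ j) * A (interiorIndex ℓ) i j =
    ∑ ℓ : ι → Fin L, ∑ i : interiorIndex ℓ, pam (ℓ i) ^ 2 * A (interiorIndex ℓ) i i := by
  -- Extension by zero outside `I` makes the index types independent of `ℓ`, so the sums can be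
  -- exchanged.
  let B : ι → ι → Finset ι → ℝ := fun i j I =>
    if h : i ∈ I ∧ j ∈ I then A I ⟨i, h.1⟩ ⟨j, h.2⟩ else 0
  have hB : ∀ (I : Finset ι) (i j : I), B i j I = A I i j := fun I i j => by
    simp [B]
  have hsub : ∀ (I : Finset ι) (f : ι → ℝ), (∀ i ∉ I, f i = 0) → ∑ i : I, f i = ∑ i, f i := by
    intro I f hf
    rw [Finset.sum_coe_sort I f]
    exact Finset.sum_subset (Finset.subset_univ _) fun i _ hi => hf i hi
  have hl : ∀ ℓ : ι → Fin L, ∑ i : interiorIndex ℓ, ∑ j : interiorIndex ℓ,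
      pam (ℓ i) * pam (ℓ j) * A (interiorIndex ℓ) i j =
      ∑ i, ∑ j, pam (ℓ i) * pam (ℓ j) * B i j (interiorIndex ℓ) := by
    intro ℓ
    simp only [← hB]
    rw [← hsub (interiorIndex ℓ)]
    · refine Finset.sum_congr rfl fun i _ => ?_
      rw [← hsub (interiorIndex ℓ)]
      intro j hj
      simp [B, hj]
    · intro i hi
      simp [B, hi]
  have hr : ∀ ℓ : ι → Fin L, ∑ i : interiorIndex ℓ, pam (ℓ i) ^ 2 * A (interiorIndex ℓ) i i =
      ∑ i, pam (ℓ i) * pam (ℓ i) * B i i (interiorIndex ℓ) := by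
    intro ℓ
    simp only [← hB]
    rw [← hsub (interiorIndex ℓ)]
    · exact Finset.sum_congr rfl fun i _ => by rw [sq]
    · intro i hi
      simp [B, hi]
  simp only [hl, hr]
  rw [Finset.sum_comm, Finset.sum_comm (t := Finset.univ (α := ι))]
  refine Finset.sum_congr rfl fun i _ => ?_
  rw [Finset.sum_comm, Finset.sum_eq_single i]
  · intro j _ hj
    exact sum_pam_mul_pam_mul_eq_zero (B i j) hj.symm
  · simp

theorem card_mul_sum_apply (f : Fin L → ℝ) (i : ι) :
    (L : ℝ) * ∑ ℓ : ι → Fin L, f (ℓ i) = (L : ℝ) ^ Fintype.card ι * ∑ a, f a := by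
  have key : ∀ g : Fin L → ℝ, ∑ ℓ : ι → Fin L, g (ℓ i) =
      Fintype.card ({j // j ≠ i} → Fin L) * ∑ a, g a := by
    intro g
    rw [← Equiv.sum_comp (Equiv.funSplitAt i (Fin L)).symm, Fintype.sum_prod_type]
    simp [Equiv.funSplitAt, Equiv.piSplitAt, Finset.mul_sum]
  have h1 := key 1
  simp only [Pi.one_apply, Finset.sum_const, Finset.card_univ, Fintype.card_fun, Fintype.card_fin,
    nsmul_eq_mul, mul_one, Nat.cast_pow] at h1
  rw [key f, h1, Fintype.card_fun, Fintype.card_fin]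
  push_cast
  ring

theorem sum_apply_mul_apply_eq_zero (f g : Fin L → ℝ) (hg : ∑ a, g a = 0) {i j : ι}
    (hij : i ≠ j) : ∑ ℓ : ι → Fin L, f (ℓ i) * g (ℓ j) = 0 := by
  rw [← Equiv.sum_comp (Equiv.funSplitAt j (Fin L)).symm, Fintype.sum_prod_type_right]
  refine Finset.sum_eq_zero fun r _ => ?_
  simp [Equiv.funSplitAt, Equiv.piSplitAt, hij, ← Finset.mul_sum, hg]

theorem sum_fin_interior (hL : 2 ≤ L) (f : ℕ → ℝ) :
    (∑ a : Fin L, if 1 ≤ (a : ℕ) ∧ (a : ℕ) + 2 ≤ L then f a else 0) =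
      ∑ l ∈ Finset.Icc 1 (L - 2), f l := by
  rw [Fin.sum_univ_eq_sum_range (fun a => if 1 ≤ a ∧ a + 2 ≤ L then f a else 0),
    ← Finset.sum_filter]
  congr 1
  ext a
  simp only [Finset.mem_filter, Finset.mem_range, Finset.mem_Icc]
  omega

/-- The energy of the interior symbols, weighted by an affine function of their number, whose
slope is nonnegative, is at least its value at the mean number. -/
theorem le_sum_energy_mul_affine (hL : 4 ≤ L) {c c' : ℝ} (hc' : 0 ≤ c') :
    (L : ℝ) ^ Fintype.card ι *
      (Fintype.card ι * (((L : ℝ) - 2) / L) * interiorEnergy L * c) ≤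
    ∑ ℓ : ι → Fin L, ∑ i : interiorIndex ℓ, pam (ℓ i) ^ 2 *
      (c + c' * ((interiorIndex ℓ).card - Fintype.card ι * (((L : ℝ) - 2) / L))) := by
  have hL0 : (0 : ℝ) < L := by exact_mod_cast (by omega : 0 < L)
  have hL2 : (0 : ℝ) < (L : ℝ) - 2 := by
    have : (4 : ℝ) ≤ L := by exact_mod_cast hL
    linarith
  set p : ℝ := ((L : ℝ) - 2) / L with hp
  have hp1 : p ≤ 1 := by
    rw [hp, div_le_one hL0]
    linarith
  let f : Fin L → ℝ := fun a => if 1 ≤ (a : ℕ) ∧ (a : ℕ) + 2 ≤ L then pam a ^ 2 else 0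
  -- The centred interior indicator: its sum over the indices is the deviation of the number of
  -- interior symbols from its mean.
  let g : Fin L → ℝ := fun a => (if 1 ≤ (a : ℕ) ∧ (a : ℕ) + 2 ≤ L then 1 else 0) - p
  have hf0 : ∀ a, 0 ≤ f a := fun a => by
    simp only [f]
    split_ifs <;> positivity
  have hfsum : ∑ a, f a = ((L : ℝ) - 2) * interiorEnergy L := by
    have := sum_fin_interior (by omega : 2 ≤ L) fun l => (2 * (l : ℝ) - (L : ℝ) + 1) ^ 2
    rw [interiorEnergy, mul_div_cancel₀ _ hL2.ne', ← this]
    rfl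
  have hg : ∑ a, g a = 0 := by
    have := sum_fin_interior (by omega : 2 ≤ L) fun _ => 1
    simp only [g, Finset.sum_sub_distrib, this]
    simp only [Finset.sum_const, Nat.card_Icc, Finset.card_univ, Fintype.card_fin, nsmul_eq_mul, hp]
    rw [show L - 2 + 1 - 1 = L - 2 by omega, Nat.cast_sub (by omega)]
    field_simp
    push_cast
    ring
  have hrow : ∀ ℓ : ι → Fin L, ∑ i : interiorIndex ℓ, pam (ℓ i) ^ 2 *
      (c + c' * ((interiorIndex ℓ).card - Fintype.card ι * p)) =
      c * ∑ i, f (ℓ i) + c' * ∑ i, ∑ j, f (ℓ i) * g (ℓ j) := by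
    intro ℓ
    have h1 : ∑ i : interiorIndex ℓ, pam (ℓ i) ^ 2 = ∑ i, f (ℓ i) := by
      rw [Finset.sum_coe_sort (interiorIndex ℓ) fun i => pam (ℓ i) ^ 2, interiorIndex,
        Finset.sum_filter]
    have h2 : ((interiorIndex ℓ).card : ℝ) - Fintype.card ι * p = ∑ j, g (ℓ j) := by
      simp [g, interiorIndex, Finset.sum_sub_distrib]
    rw [← Finset.sum_mul, h1, h2, ← Finset.sum_mul_sum]
    ring
  have henergy : ∑ ℓ : ι → Fin L, ∑ i, f (ℓ i) =
      (L : ℝ) ^ Fintype.card ι * (Fintype.card ι * p * interiorEnergy L) := by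
    rw [Finset.sum_comm]
    have : ∀ i : ι, ∑ ℓ : ι → Fin L, f (ℓ i) =
        (L : ℝ) ^ Fintype.card ι * (p * interiorEnergy L) := fun i => by
      have := card_mul_sum_apply f i
      rw [hfsum] at this
      rw [hp]
      field_simp
      linarith
    simp only [this, Finset.sum_const, Finset.card_univ, nsmul_eq_mul]
    ring
  -- Terms with distinct indices vanish by independence; on the diagonal, `f` is supported where `g
  -- = 1 - p ≥ 0`.
  have hcov : 0 ≤ ∑ ℓ : ι → Fin L, ∑ i, ∑ j, f (ℓ i) * g (ℓ j) := by
    rw [Finset.sum_comm]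
    refine Finset.sum_nonneg fun i _ => ?_
    rw [Finset.sum_comm, Finset.sum_eq_single i]
    · refine Finset.sum_nonneg fun ℓ _ => ?_
      by_cases hi : 1 ≤ (ℓ i : ℕ) ∧ (ℓ i : ℕ) + 2 ≤ L
      · refine mul_nonneg (hf0 _) ?_
        simp only [g, if_pos hi]
        linarith
      · simp [f, hi]
    · intro j _ hj
      exact sum_apply_mul_apply_eq_zero f g hg hj.symm
    · simp
  simp only [hrow]
  rw [Finset.sum_add_distrib, ← Finset.mul_sum, ← Finset.mul_sum, henergy]
  have := mul_nonneg hc' hcov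
  linarith

end Message

/-! ### Assembly of the bound. -/

section Bound

theorem ofReal_sum_le {α : Type*} (s : Finset α) (f : α → ℝ) :
    ENNReal.ofReal (∑ i ∈ s, f i) ≤ ∑ i ∈ s, ENNReal.ofReal (f i) :=
  Finset.le_sum_of_subadditive _ ENNReal.ofReal_zero.le (fun _ _ => ENNReal.ofReal_add_le) s f

theorem sum_diag_le_expectedRelaxedValue {K N L : ℕ} (hKN : K ≤ N) :
    ((L : ℝ≥0∞) ^ (2 * K))⁻¹ * ∑ ℓ : Fin K ⊕ Fin K → Fin L, ∑ i : interiorIndex ℓ,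
      ENNReal.ofReal (pam (ℓ i) ^ 2) * ∫⁻ h : Fin K → Fin N → ℂ,
        ENNReal.ofReal ((gram h (interiorIndex ℓ))⁻¹ i i) ∂(channelLaw K N) ≤
      expectedRelaxedValue K N L := by
  rw [expectedRelaxedValue_eq]
  refine mul_le_mul' le_rfl ?_
  have hmeas : ∀ ℓ : Fin K ⊕ Fin K → Fin L, Measurable fun h : Fin K → Fin N → ℂ =>
      ENNReal.ofReal (∑ i : interiorIndex ℓ, ∑ j : interiorIndex ℓ,
        pam (ℓ i) * pam (ℓ j) * (gram h (interiorIndex ℓ))⁻¹ i j) := fun ℓ =>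
    (Finset.measurable_sum _ fun i _ => Finset.measurable_sum _ fun j _ =>
      (measurable_gram_inv _ i j).const_mul _).ennreal_ofReal
  calc ∑ ℓ : Fin K ⊕ Fin K → Fin L, ∑ i : interiorIndex ℓ,
        ENNReal.ofReal (pam (ℓ i) ^ 2) * ∫⁻ h : Fin K → Fin N → ℂ,
          ENNReal.ofReal ((gram h (interiorIndex ℓ))⁻¹ i i) ∂(channelLaw K N)
      = ∫⁻ h : Fin K → Fin N → ℂ, ∑ ℓ : Fin K ⊕ Fin K → Fin L, ∑ i : interiorIndex ℓ,
          ENNReal.ofReal (pam (ℓ i) ^ 2) *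
            ENNReal.ofReal ((gram h (interiorIndex ℓ))⁻¹ i i) ∂(channelLaw K N) := by
        have h1 : ∀ (ℓ : Fin K ⊕ Fin K → Fin L) (i : interiorIndex ℓ),
            Measurable fun h : Fin K → Fin N → ℂ => ENNReal.ofReal (pam (ℓ i) ^ 2) *
              ENNReal.ofReal ((gram h (interiorIndex ℓ))⁻¹ i i) := fun ℓ i =>
          (measurable_gram_inv _ i i).ennreal_ofReal.const_mul _
        rw [lintegral_finsetSum _ fun ℓ _ => Finset.measurable_sum _ fun i _ => h1 ℓ i]
        refine Finset.sum_congr rfl fun ℓ _ => ?_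
        rw [lintegral_finsetSum _ fun i _ => h1 ℓ i]
        refine Finset.sum_congr rfl fun i _ => ?_
        rw [lintegral_const_mul _ (measurable_gram_inv _ i i).ennreal_ofReal]
    _ ≤ ∫⁻ h : Fin K → Fin N → ℂ, ∑ ℓ : Fin K ⊕ Fin K → Fin L,
          ENNReal.ofReal (∑ i : interiorIndex ℓ, ∑ j : interiorIndex ℓ,
            pam (ℓ i) * pam (ℓ j) * (gram h (interiorIndex ℓ))⁻¹ i j) ∂(channelLaw K N) := by
        refine lintegral_mono_ae ((ae_linearIndependent hKN).mono fun h hh => ?_)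
        -- The off-diagonal terms cancel only in the real sum over all messages, so that sum is
        -- formed inside `ENNReal.ofReal` first.
        refine le_trans (le_of_eq ?_) (ofReal_sum_le _ _)
        have hnn : ∀ (ℓ : Fin K ⊕ Fin K → Fin L) (i : interiorIndex ℓ),
            0 ≤ pam (ℓ i) ^ 2 * (gram h (interiorIndex ℓ))⁻¹ i i := fun ℓ i =>
          mul_nonneg (sq_nonneg _) (posDef_gram hh _).inv.diag_pos.le
        rw [sum_quadratic_eq_sum_diag fun I => (gram h I)⁻¹,
          ENNReal.ofReal_sum_of_nonneg fun ℓ _ => Finset.sum_nonneg fun i _ => hnn ℓ i]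
        refine Finset.sum_congr rfl fun ℓ _ => ?_
        rw [ENNReal.ofReal_sum_of_nonneg fun i _ => hnn ℓ i]
        exact Finset.sum_congr rfl fun i _ => (ENNReal.ofReal_mul (sq_nonneg _)).symm
    _ = ∑ ℓ : Fin K ⊕ Fin K → Fin L, ∫⁻ h : Fin K → Fin N → ℂ,
          ENNReal.ofReal (∑ i : interiorIndex ℓ, ∑ j : interiorIndex ℓ,
            pam (ℓ i) * pam (ℓ j) * (gram h (interiorIndex ℓ))⁻¹ i j) ∂(channelLaw K N) :=
        lintegral_finsetSum _ fun ℓ _ => hmeas ℓ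
    _ = ∑ m : Fin K → Fin (L ^ 2), ∫⁻ h : Fin K → Fin N → ℂ,
          ENNReal.ofReal (∑ i : interiorIndex (messageEquiv K L m),
            ∑ j : interiorIndex (messageEquiv K L m),
            pam (messageEquiv K L m i) * pam (messageEquiv K L m j) *
              (gram h (interiorIndex (messageEquiv K L m)))⁻¹ i j) ∂(channelLaw K N) :=
        ((messageEquiv K L).sum_comp fun ℓ => ∫⁻ h : Fin K → Fin N → ℂ,
          ENNReal.ofReal (∑ i : interiorIndex ℓ, ∑ j : interiorIndex ℓ,
            pam (ℓ i) * pam (ℓ j) * (gram h (interiorIndex ℓ))⁻¹ i j) ∂(channelLaw K N)).symm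
    _ ≤ _ := Finset.sum_le_sum fun m _ =>
        lintegral_mono_ae ((ae_linearIndependent hKN).mono fun h hh =>
          ENNReal.ofReal_le_ofReal (le_relaxedValue hh m))

/-- The tangent line of `n ↦ 2 / (2 N - n)` at `2 N - D` bounds the mean of the inverse Gram
matrix from below. -/
theorem tangent_le_lintegral_gram_inv {K N : ℕ} (hKN : K ≤ N) (I : Finset (Fin K ⊕ Fin K)) (i : I)
    {D : ℝ} (hD : 0 < D) :
    ENNReal.ofReal (2 / D + 2 / D ^ 2 * (I.card - (2 * N - D))) ≤
      ∫⁻ h : Fin K → Fin N → ℂ, ENNReal.ofReal ((gram h I)⁻¹ i i) ∂(channelLaw K N) := by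
  set v := 2 / D + 2 / D ^ 2 * (I.card - (2 * N - D)) with hv
  rcases le_or_gt v 0 with h0 | h0
  · simp [ENNReal.ofReal_of_nonpos h0]
  -- With `b = 2 / v`, the condition is `(2N - |I|) v ≤ 2`, which is the tangent inequality without
  -- its denominator and so also covers `|I| = 2N`.
  · have := le_lintegral_gram_inv hKN I i (b := 2 / v) (by positivity) (by
      rw [le_div_iff₀ h0]
      have : (2 * (N : ℝ) - I.card) * v = 2 - 2 * (D - (2 * (N : ℝ) - I.card)) ^ 2 / D ^ 2 := by
        rw [hv]
        field_simp
        ring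
      rw [this]
      have : 0 ≤ 2 * (D - (2 * (N : ℝ) - I.card)) ^ 2 / D ^ 2 := by positivity
      linarith)
    rwa [div_div_cancel₀ two_ne_zero] at this

theorem lowerBound_le_expectedRelaxedValue {K N L : ℕ} (hL : 4 ≤ L) (hK : 0 < K) (hKN : K ≤ N) :
    ENNReal.ofReal (lowerBound L ((N : ℝ) / K)) ≤ expectedRelaxedValue K N L := by
  have hL0 : (0 : ℝ) < L := by exact_mod_cast (by omega : 0 < L)
  have hL2 : (0 : ℝ) < (L : ℝ) - 2 := by
    have : (4 : ℝ) ≤ L := by exact_mod_cast hL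
    linarith
  have hK0 : (0 : ℝ) < K := by exact_mod_cast hK
  have hKN' : (K : ℝ) ≤ N := by exact_mod_cast hKN
  set p : ℝ := ((L : ℝ) - 2) / L with hp
  have hp0 : 0 < p := by positivity
  have hp1 : p < 1 := by
    rw [hp, div_lt_one hL0]
    linarith
  -- The tangent point is the mean number `2 K p` of interior symbols. Since `p < 1`, `D` is
  -- positive even when `N = K`.
  set D : ℝ := 2 * N - 2 * K * p with hDdef
  have hD : 0 < D := by nlinarith
  have hbound : lowerBound L ((N : ℝ) / K) = 2 * K * p * interiorEnergy L * (2 / D) := by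
    have h1 : (N : ℝ) / K * L / ((L : ℝ) - 2) - 1 = D / (2 * K * p) := by
      rw [hDdef, hp]
      field_simp
    rw [lowerBound, h1]
    field_simp
  refine le_trans ?_ (sum_diag_le_expectedRelaxedValue hKN)
  have hcard : (Fintype.card (Fin K ⊕ Fin K) : ℝ) = 2 * K := by
    rw [Fintype.card_sum, Fintype.card_fin]
    push_cast
    ring
  have hsum : ENNReal.ofReal ((L : ℝ) ^ (2 * K) * lowerBound L ((N : ℝ) / K)) ≤
      ∑ ℓ : Fin K ⊕ Fin K → Fin L, ∑ i : interiorIndex ℓ,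
        ENNReal.ofReal (pam (ℓ i) ^ 2) * ∫⁻ h : Fin K → Fin N → ℂ,
          ENNReal.ofReal ((gram h (interiorIndex ℓ))⁻¹ i i) ∂(channelLaw K N) := by
    have henergy := le_sum_energy_mul_affine (ι := Fin K ⊕ Fin K) hL (c := 2 / D)
      (c' := 2 / D ^ 2) (by positivity)
    rw [hcard, ← hp, ← hbound, show Fintype.card (Fin K ⊕ Fin K) = 2 * K by simp [two_mul]]
      at henergy
    refine (ENNReal.ofReal_le_ofReal henergy).trans ((ofReal_sum_le _ _).trans ?_)
    refine Finset.sum_le_sum fun ℓ _ => (ofReal_sum_le _ _).trans ?_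
    refine Finset.sum_le_sum fun i _ => ?_
    rw [ENNReal.ofReal_mul (sq_nonneg _)]
    gcongr
    have := tangent_le_lintegral_gram_inv hKN (interiorIndex ℓ) i hD
    rwa [show 2 * (N : ℝ) - D = 2 * K * p by rw [hDdef]; ring] at this
  calc ENNReal.ofReal (lowerBound L ((N : ℝ) / K))
      = ((L : ℝ≥0∞) ^ (2 * K))⁻¹ *
          ENNReal.ofReal ((L : ℝ) ^ (2 * K) * lowerBound L ((N : ℝ) / K)) := by
        have hne : (L : ℝ≥0∞) ^ (2 * K) ≠ 0 := pow_ne_zero _ (by simp; omega)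
        have hnt : (L : ℝ≥0∞) ^ (2 * K) ≠ ⊤ := ENNReal.pow_ne_top (by simp)
        rw [ENNReal.ofReal_mul (by positivity), ENNReal.ofReal_pow hL0.le, ENNReal.ofReal_natCast,
          ← mul_assoc, ENNReal.inv_mul_cancel hne hnt, one_mul]
    _ ≤ _ := by gcongr

end Bound

end QamCip

end

theorem proposition1 (L : ℕ) (hL : 4 ≤ L) (hLeven : Even L) :
    (∀ (K Nt : ℕ) (η : ℝ), 0 < K → η = (Nt : ℝ) / (K : ℝ) → 1 < η →
      ENNReal.ofReal (QamCip.lowerBound L η) ≤ QamCip.expectedRelaxedValue K Nt L) ∧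
    ENNReal.ofReal (QamCip.lowerBound L 1) ≤
      liminf (fun K : ℕ => QamCip.expectedRelaxedValue K K L) atTop := by
  constructor
  · rintro K Nt η hK rfl hη
    have hK0 : (0 : ℝ) < K := by exact_mod_cast hK
    rw [one_lt_div hK0] at hη
    exact QamCip.lowerBound_le_expectedRelaxedValue hL hK (by exact_mod_cast hη.le)
  · refine le_liminf_of_le (by isBoundedDefault) ?_
    filter_upwards [eventually_gt_atTop 0] with K hK
    have := QamCip.lowerBound_le_expectedRelaxedValue hL hK le_rfl
    rwa [div_self (by exact_mod_cast hK.ne')] at this
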